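/- All digraphs are finite and have neither loops nor parallel arcs, but two opposite arcs $uv$, $vu$ between two vertices are allowed. For a digraph $D$, $d_D^+(v)$ and $d_D^-(v)$ denote the out-degree and the in-degree of a vertex $v$, and $\Delta^+(D)$ the maximum out-degree; $D$ is Eulerian if $d_D^+(v)=d_D^-(v)$ for all vertices $v$, and connected if its underlying undirected graph has exactly one component. A separating vertex of a connected digraph $D$ is a vertex $v$ such that $D-v$ has at least two components. A block of $D$ is a maximal connected subdigraph of $D$ that has no separating vertex of its own; $\mathscr{B}(D)$ is the set of blocks of $D$ and $\mathscr{B}_v(D)$ the set of those containing the vertex $v$. A bidirected graph is a digraph obtained from a simple undirected graph by replacing every edge by two opposite arcs; a single vertex counts as a bidirected complete graph. Given a set $\Gamma$ of colors and a list-assignment $L:V(D)\to 2^{\Gamma}$, the digraph $D$ is $L$-colorable if there is a map $\varphi:V(D)\to\Gamma$ such that $\varphi(v)\in L(v)$ for all $v\in V(D)$ and, for each $\alpha\in\Gamma$, the subdigraph of $D$ induced by $\varphi^{-1}(\alpha)$ contains no directed cycle. **Theorem.** Let $D$ be a connected digraph, and let $L$ be a list-assignment such that $|L(v)|\ge\max\{d_D^+(v),d_D^-(v)\}$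 for all $v\in V(D)$. Suppose that $D$ is not $L$-colorable. Then the following statements hold: (a) $D$ is Eulerian and $|L(v)|=d_D^+(v)=d_D^-(v)$ for all $v\in V(D)$. (b) If $B\in\mathscr{B}(D)$, then $B$ is a directed cycle of length at least $2$, a bidirected complete graph, or a bidirected cycle of odd length at least $5$. (c) For each $B\in\mathscr{B}(D)$ there is a set $\Gamma_B\subseteq\Gamma$ of exactly $\Delta^+(B)$ colors such that, for every $v\in V(D)$, the sets $\Gamma_B$ with $B\in\mathscr{B}_v(D)$ are pairwise disjoint and $L(v)=\bigcup_{B\in\mathscr{B}_v(D)}\Gamma_B$. -/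

import Mathlib

/-! Digraphs are Mathlib's `Digraph V`: a set of vertices `V` with an arc relation `Adj`, hence
without parallel arcs; opposite arcs are allowed.  Loops are excluded by a hypothesis. -/

namespace Digraph

variable {V : Type*}

/-- `D` has no loops. -/
def Loopless (D : Digraph V) : Prop := ∀ v, ¬ D.Adj v v

/-- The underlying simple graph `G(D)`: `u ≠ v` are joined iff `uv` or `vu` is an arc. -/
def underlying (D : Digraph V) : SimpleGraph V := D.toSimpleGraphInclusive

/-- `D` is connected: its underlying graph has precisely one component. -/
def IsConnected (D : Digraph V) : Prop := D.underlying.Connected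

/-- The out-degree of `v`. -/
noncomputable def outDegree (D : Digraph V) (v : V) : ℕ := {w | D.Adj v w}.ncard

/-- The in-degree of `v`. -/
noncomputable def inDegree (D : Digraph V) (v : V) : ℕ := {u | D.Adj u v}.ncard

/-- The maximum out-degree of a (finite) digraph. -/
noncomputable def maxOutDegree (D : Digraph V) : ℕ := ⨆ v, D.outDegree v

/-- Every vertex has equal out-degree and in-degree. -/
def IsEulerian (D : Digraph V) : Prop := ∀ v, D.outDegree v = D.inDegree v

/-- A subdigraph of `D`: a set of vertices and a set of arcs of `D` between them. -/
@[ext]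
structure Subdigraph (D : Digraph V) where
  verts : Set V
  Adj : V → V → Prop
  adj_sub : ∀ {u v}, Adj u v → D.Adj u v
  fst_mem : ∀ {u v}, Adj u v → u ∈ verts
  snd_mem : ∀ {u v}, Adj u v → v ∈ verts

namespace Subdigraph

variable {D : Digraph V}

/-- A subdigraph, as a digraph in its own right. -/
def coe (H : D.Subdigraph) : Digraph H.verts where
  Adj u v := H.Adj u v

/-- The subdigraph relation: containment of vertices and of arcs. -/
instance : PartialOrder D.Subdigraph where
  le H K := H.verts ⊆ K.verts ∧ ∀ u v, H.Adj u v → K.Adj u v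
  le_refl _ := ⟨subset_rfl, fun _ _ h => h⟩
  le_trans _ _ _ h k := ⟨h.1.trans k.1, fun u v a => k.2 u v (h.2 u v a)⟩
  le_antisymm _ _ h k := Subdigraph.ext (h.1.antisymm k.1)
    (funext fun u => funext fun v => propext ⟨h.2 u v, k.2 u v⟩)

end Subdigraph

/-- The subdigraph `D[X]` induced by the vertex set `X`. -/
def induced (D : Digraph V) (X : Set V) : D.Subdigraph where
  verts := X
  Adj u v := D.Adj u v ∧ u ∈ X ∧ v ∈ X
  adj_sub h := h.1
  fst_mem h := h.2.1
  snd_mem h := h.2.2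

/-- For connected `D`: the digraph `D - v` is disconnected, that is, it has two vertices lying in
different components.  (The vertex of a one-vertex digraph is therefore not separating.) -/
def IsSeparatingVertex (D : Digraph V) (v : V) : Prop :=
  ¬ (D.induced {v}ᶜ).coe.underlying.Preconnected

/-- The blocks of `D`: the maximal connected subdigraphs without a separating vertex. -/
def blocks (D : Digraph V) : Set D.Subdigraph :=
  {B | Maximal (fun H : D.Subdigraph =>
    H.coe.IsConnected ∧ ∀ v, ¬ H.coe.IsSeparatingVertex v) B}

/-- The blocks of `D` that contain the vertex `v`. -/
def blocksAt (D : Digraph V) (v : V) : Set D.Subdigraph :=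
  {B | B ∈ D.blocks ∧ v ∈ B.verts}

/-- The directed cycle `0 → 1 → ⋯ → n - 1 → 0` (used for `n ≥ 2`). -/
def dicycle (n : ℕ) : Digraph (ZMod n) where
  Adj i j := j = i + 1

/-- The bidirected graph `D(G)`: every edge of `G` is replaced by two opposite arcs. -/
def bidirected (G : SimpleGraph V) : Digraph V where
  Adj := G.Adj

/-- `D` is (isomorphic to) a directed cycle of length at least two. -/
def IsDirectedCycle (D : Digraph V) : Prop :=
  ∃ n : ℕ, 2 ≤ n ∧ Nonempty (D.Adj ≃r (dicycle n).Adj)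

/-- `D` is a bidirected complete graph. -/
def IsBidirectedComplete (D : Digraph V) : Prop := D = bidirected ⊤

/-- `D` is (isomorphic to) a bidirected cycle of odd length at least five. -/
def IsBidirectedLongOddCycle (D : Digraph V) : Prop :=
  ∃ n : ℕ, 5 ≤ n ∧ Odd n ∧ Nonempty (D.Adj ≃r (bidirected (SimpleGraph.cycleGraph n)).Adj)

/-- `D` (without loops) contains no directed cycle. -/
def IsAcyclic (D : Digraph V) : Prop := ∀ H : D.Subdigraph, ¬ H.coe.IsDirectedCycle

/-- `φ` is an `L`-coloring of `D`: colors come from the lists, and every color class induces an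
acyclic subdigraph. -/
def IsListColoring {Γ : Type*} (D : Digraph V) (L : V → Set Γ) (φ : V → Γ) : Prop :=
  (∀ v, φ v ∈ L v) ∧ ∀ α : Γ, (D.induced (φ ⁻¹' {α})).coe.IsAcyclic

/-- `D` is `L`-colorable. -/
def ListColorable {Γ : Type*} (D : Digraph V) (L : V → Set Γ) : Prop :=
  ∃ φ : V → Γ, D.IsListColoring L φ

end Digraph

/-! When some vertices are colored, the color of an out-neighbor only endangers the out-list of a
vertex, and that of an in-neighbor only the in-list. Lists therefore come in pairs, one per
direction, each bounding the degree in that direction. `IsColoringOn` is the matching notion of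
coloring; for equal lists it gives acyclic color classes. Coloring part of a bad (degree-feasible,
uncolorable) set leaves a bad set (`BadOn.residual`). Greedy coloring reaches every proper part of a
connected set, so bad lists have exactly the size of the degrees (`BadOn.encard_eq`).

In a block, `X \ {v}` stays connected, and tightness before and after coloring `v` forces all
nonempty lists to be one set `K` (`Nonsep.exists_const`). If `K` is empty, the block is a single
vertex; if `|K| = 1`, a directed cycle. Let `|K| ≥ 2`. If some `X \ {v}` is a block, uniform
residual lists join `v` both ways to everything, and regularity makes `X` complete. Otherwise every
`v` is joined both ways to the interiors of two end blocks of `X \ {v}`; counting gives `|K| = 2`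
and a bidirected cycle, which cannot be even (`Nonsep.shape`).

At a separating vertex `x`, color `X \ {x}`. The out-neighbors of `x` carry each color of `L x`
once, and so do the in-neighbors; on each side of `x` the two color sets agree
(`IsPart.image_subset_image_not`). So each side, with its share of `L x`, is bad again, and
induction applies (`BadOn.structure`). -/

namespace Digraph

/-! ### Pairs of lists, residual lists and greedy coloring. -/

variable {V Γ : Type*} {D : Digraph V}

/-- The out-neighbours (`b = true`) or in-neighbours (`b = false`) of `v`. -/
def nbr (D : Digraph V) (b : Bool) (v : V) : Set V :=
  {w | cond b (D.Adj v w) (D.Adj w v)}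

theorem mem_nbr_not {b : Bool} {v w : V} : w ∈ D.nbr (!b) v ↔ v ∈ D.nbr b w := by
  cases b <;> rfl

theorem Loopless.notMem_nbr (h : D.Loopless) (b : Bool) (v : V) : v ∉ D.nbr b v := by
  cases b <;> exact h v

theorem Loopless.ne_of_mem_nbr (h : D.Loopless) {b : Bool} {v w : V} (hw : w ∈ D.nbr b v) :
    w ≠ v := by
  rintro rfl
  exact h.notMem_nbr b w hw

/-- `X` induces a digraph with at most one component: each proper nonempty part of `X` is joined to
the rest of `X`. -/
def ConnOn (D : Digraph V) (X : Set V) : Prop :=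
  ∀ A ⊆ X, A.Nonempty → (X \ A).Nonempty → ∃ a ∈ A, ∃ c ∈ X \ A, ∃ b, c ∈ D.nbr b a

/-- `X` induces a connected digraph without separating vertex. -/
def Nonsep (D : Digraph V) (X : Set V) : Prop :=
  X.Nonempty ∧ D.ConnOn X ∧ ∀ v ∈ X, D.ConnOn (X \ {v})

/-- A pair of lists for each vertex, one of which bounds the out-degrees in `X` and the other one
the in-degrees. -/
def DegreeFeasible (D : Digraph V) (X : Set V) (L : Bool → V → Set Γ) : Prop :=
  ∀ v ∈ X, ∀ b, (D.nbr b v ∩ X).encard ≤ (L b v).encard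

/-- Colorings for pairs of lists: each nonempty monochromatic set contains a vertex which is a sink
and has the color in its out-list, or which is a source and has the color in its in-list. -/
def IsColoringOn (D : Digraph V) (X : Set V) (L : Bool → V → Set Γ) (φ : V → Γ) : Prop :=
  ∀ T ⊆ X, T.Nonempty → ∀ α, (∀ v ∈ T, φ v = α) →
    ∃ v ∈ T, ∃ b, α ∈ L b v ∧ ∀ w ∈ T, w ∉ D.nbr b v

/-- `X` is degree-feasible for `L` but has no coloring. -/
def BadOn (D : Digraph V) (X : Set V) (L : Bool → V → Set Γ) : Prop :=
  D.DegreeFeasible X L ∧ ¬ ∃ φ, D.IsColoringOn X L φ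

/-- The lists that remain when `Q` has been colored by `φ`. -/
def residual (D : Digraph V) (L : Bool → V → Set Γ) (φ : V → Γ) (Q : Set V) :
    Bool → V → Set Γ :=
  fun b v => L b v \ φ '' (D.nbr b v ∩ Q)

theorem IsColoringOn.mono {X Y : Set V} {L : Bool → V → Set Γ} {φ : V → Γ}
    (h : D.IsColoringOn X L φ) (hY : Y ⊆ X) : D.IsColoringOn Y L φ :=
  fun T hT => h T (hT.trans hY)

theorem IsColoringOn.congr {X : Set V} {L M : Bool → V → Set Γ} {φ ψ : V → Γ}
    (h : D.IsColoringOn X L φ) (hL : ∀ v ∈ X, ∀ b, L b v = M b v) (hφ : ∀ v ∈ X, φ v = ψ v) :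
    D.IsColoringOn X M ψ := by
  intro T hT hne α hα
  obtain ⟨v, hv, b, hb, h'⟩ := h T hT hne α fun v hv => (hφ v (hT hv)).trans (hα v hv)
  exact ⟨v, hv, b, hL v (hT hv) b ▸ hb, h'⟩

theorem BadOn.congr {X : Set V} {L M : Bool → V → Set Γ} (h : D.BadOn X L)
    (hL : ∀ v ∈ X, ∀ b, L b v = M b v) : D.BadOn X M :=
  ⟨fun v hv b => hL v hv b ▸ h.1 v hv b, fun ⟨φ, hφ⟩ =>
    h.2 ⟨φ, hφ.congr (fun v hv b => (hL v hv b).symm) fun _ _ => rfl⟩⟩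

theorem IsColoringOn.exists_mem {X : Set V} {L : Bool → V → Set Γ} {φ : V → Γ}
    (h : D.IsColoringOn X L φ) {v : V} (hv : v ∈ X) : ∃ b, φ v ∈ L b v := by
  obtain ⟨w, rfl, b, hb, -⟩ := h {v} (by simpa) (by simp) (φ v) (by simp)
  exact ⟨b, hb⟩

theorem isColoringOn_singleton (hD : D.Loopless) {L : Bool → V → Set Γ} {φ : V → Γ} {v : V}
    {b : Bool} (h : φ v ∈ L b v) : D.IsColoringOn {v} L φ := by
  intro T hT hne α hα
  obtain rfl := (hne.subset_singleton_iff.mp hT)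
  obtain rfl := hα v rfl
  refine ⟨v, rfl, b, h, ?_⟩
  rintro _ rfl
  exact hD.notMem_nbr b _

theorem isColoringOn_empty {L : Bool → V → Set Γ} {φ : V → Γ} : D.IsColoringOn ∅ L φ :=
  fun _ hT hne => absurd (hne.mono hT) (by simp)

/-- A coloring of `Q` and a coloring of the rest from the residual lists fit together. -/
theorem IsColoringOn.union {Q R : Set V} {L : Bool → V → Set Γ} {φ ψ χ : V → Γ}
    (hφ : D.IsColoringOn Q L φ) (hψ : D.IsColoringOn R (D.residual L φ Q) ψ)
    (hQ : ∀ v ∈ Q, χ v = φ v) (hR : ∀ v ∈ R, χ v = ψ v) : D.IsColoringOn (Q ∪ R) L χ := by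
  intro T hT hne α hα
  by_cases hTR : (T ∩ R).Nonempty
  · obtain ⟨v, hv, b, hb, h⟩ := hψ (T ∩ R) Set.inter_subset_right hTR α
      fun v hv => (hR v hv.2).symm.trans (hα v hv.1)
    refine ⟨v, hv.1, b, hb.1, fun w hw hwv => ?_⟩
    rcases hT hw with h' | h'
    -- The residual list at `v` has lost the colors of the `b`-neighbors in `Q`, so none of them has
    -- color `α`.
    · exact hb.2 ⟨w, ⟨hwv, h'⟩, (hQ w h').symm.trans (hα w hw)⟩
    · exact h w ⟨hw, h'⟩ hwv
  · have hTQ : T ⊆ Q := fun v hv => (hT hv).resolve_right fun h => hTR ⟨v, hv, h⟩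
    exact hφ T hTQ hne α fun v hv => (hQ v (hTQ hv)).symm.trans (hα v hv)

theorem IsColoringOn.exists_union {Q R : Set V} {L : Bool → V → Set Γ} {φ ψ : V → Γ}
    (hφ : D.IsColoringOn Q L φ) (hψ : D.IsColoringOn R (D.residual L φ Q) ψ)
    (hd : Disjoint Q R) : ∃ χ, D.IsColoringOn (Q ∪ R) L χ := by
  classical
  refine ⟨Q.piecewise φ ψ, hφ.union hψ (fun v hv => Set.piecewise_eq_of_mem _ _ _ hv)
    fun v hv => Set.piecewise_eq_of_notMem _ _ _ fun h => Set.disjoint_left.mp hd h hv⟩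

theorem IsColoringOn.insert (hD : D.Loopless) {Q : Set V} {L : Bool → V → Set Γ} {φ : V → Γ}
    (hφ : D.IsColoringOn Q L φ) {v : V} (hv : v ∉ Q) {b : Bool} {α : Γ} (hα : α ∈ L b v)
    (h : α ∉ φ '' (D.nbr b v ∩ Q)) : ∃ χ, D.IsColoringOn (insert v Q) L χ := by
  have := hφ.exists_union (R := {v}) (ψ := fun _ => α)
    (isColoringOn_singleton hD (b := b) ⟨hα, h⟩) (by simpa)
  rwa [Set.union_singleton] at this

theorem DegreeFeasible.residual [Finite V] {X Q : Set V} {L : Bool → V → Set Γ}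
    (h : D.DegreeFeasible X L) (hQ : Q ⊆ X) (φ : V → Γ) :
    D.DegreeFeasible (X \ Q) (D.residual L φ Q) := by
  intro v hv b
  have h1 : (D.nbr b v ∩ Q).encard + (D.nbr b v ∩ (X \ Q)).encard = (D.nbr b v ∩ X).encard := by
    rw [← Set.encard_union_eq, ← Set.inter_union_distrib_left, Set.union_sdiff_cancel hQ]
    exact (Set.disjoint_sdiff_right).mono Set.inter_subset_right Set.inter_subset_right
  have h2 := Set.encard_le_encard_sdiff_add_encard (L b v) (φ '' (D.nbr b v ∩ Q))
  have h3 : (φ '' (D.nbr b v ∩ Q)).encard ≤ (D.nbr b v ∩ Q).encard := Set.encard_image_le _ _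
  have h4 := h v hv.1 b
  have h5 : (D.nbr b v ∩ Q).encard ≠ ⊤ := Set.encard_ne_top_iff.mpr (Set.toFinite _)
  refine (ENat.add_le_add_iff_left h5).mp ?_
  rw [h1]
  refine h4.trans (h2.trans ?_)
  rw [add_comm]
  exact add_le_add_left h3 _

theorem BadOn.residual [Finite V] {X Q : Set V} {L : Bool → V → Set Γ} (h : D.BadOn X L)
    (hQ : Q ⊆ X) {φ : V → Γ} (hφ : D.IsColoringOn Q L φ) :
    D.BadOn (X \ Q) (D.residual L φ Q) := by
  refine ⟨h.1.residual hQ φ, fun ⟨ψ, hψ⟩ => h.2 ?_⟩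
  have := hφ.exists_union hψ Set.disjoint_sdiff_right
  rwa [Set.union_sdiff_cancel hQ] at this

/-- Greedy coloring of a proper part of a connected set. -/
theorem ConnOn.exists_isColoringOn [Finite V] [Nonempty Γ] (hD : D.Loopless) {X : Set V}
    (hX : D.ConnOn X) {L : Bool → V → Set Γ} (hL : D.DegreeFeasible X L) {S : Set V} (hS : S ⊂ X) :
    ∃ φ, D.IsColoringOn S L φ := by
  induction h : S.ncard generalizing S with
  | zero =>
    rw [Set.ncard_eq_zero] at h
    subst h
    exact ⟨fun _ => Classical.arbitrary Γ, isColoringOn_empty⟩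
  | succ n ih =>
    have hne : S.Nonempty := Set.nonempty_of_ncard_ne_zero (by omega)
    -- `u` has a `b`-neighbor `c` outside `S`; if `u` is colored last, fewer than `|L b u|` colors
    -- are forbidden in direction `b`.
    obtain ⟨u, hu, c, hc, b, hb⟩ := hX S hS.1 hne (Set.nonempty_of_ssubset hS)
    obtain ⟨φ, hφ⟩ := ih (S := S \ {u}) ((Set.sdiff_subset).trans_ssubset hS)
      (by rw [Set.ncard_sdiff_singleton_of_mem hu]; omega)
    have hlt : (φ '' (D.nbr b u ∩ (S \ {u}))).encard < (L b u).encard := by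
      refine (Set.encard_image_le _ _).trans_lt (lt_of_lt_of_le ?_ (hL u (hS.1 hu) b))
      refine (Set.toFinite _).encard_lt_encard ⟨fun w hw => ⟨hw.1, hS.1 hw.2.1⟩, fun h' => ?_⟩
      exact hc.2 (h' ⟨hb, hc.1⟩).2.1
    obtain ⟨α, hα, hα'⟩ := Set.not_subset.mp fun h' => (Set.encard_le_encard h').not_gt hlt
    have := hφ.insert hD (v := u) (by simp) hα hα'
    rwa [Set.insert_sdiff_singleton, Set.insert_eq_of_mem hu] at this

/-! ### Tightness and uniformity of bad lists. -/

theorem BadOn.subset_image (hD : D.Loopless) {X : Set V} {L : Bool → V → Set Γ} (h : D.BadOn X L)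
    {v : V} (hv : v ∈ X) {φ : V → Γ} (hφ : D.IsColoringOn (X \ {v}) L φ) (b : Bool) :
    L b v ⊆ φ '' (D.nbr b v ∩ X) := by
  intro α hα
  by_contra hα'
  refine h.2 ?_
  have := hφ.insert hD (v := v) (by simp) hα fun h' => hα' (Set.image_mono
    (Set.inter_subset_inter_right _ Set.sdiff_subset) h')
  rwa [Set.insert_sdiff_singleton, Set.insert_eq_of_mem hv] at this

theorem BadOn.encard_eq [Finite V] (hD : D.Loopless) {X : Set V}
    {L : Bool → V → Set Γ} (hX : D.ConnOn X) (h : D.BadOn X L) {v : V} (hv : v ∈ X) (b : Bool) :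
    (L b v).encard = (D.nbr b v ∩ X).encard := by
  refine le_antisymm ?_ (h.1 v hv b)
  cases isEmpty_or_nonempty Γ
  · simp [Set.eq_empty_of_isEmpty]
  obtain ⟨φ, hφ⟩ := hX.exists_isColoringOn hD h.1 (S := X \ {v})
    (Set.sdiff_singleton_ssubset.mpr hv)
  exact (Set.encard_le_encard (h.subset_image hD hv hφ b)).trans (Set.encard_image_le _ _)

theorem BadOn.eq_image [Finite V] (hD : D.Loopless) {X : Set V} {L : Bool → V → Set Γ}
    (h : D.BadOn X L) {v : V} (hv : v ∈ X) {φ : V → Γ} (hφ : D.IsColoringOn (X \ {v}) L φ)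
    (b : Bool) : L b v = φ '' (D.nbr b v ∩ X) ∧ Set.InjOn φ (D.nbr b v ∩ X) := by
  have h1 := h.subset_image hD hv hφ b
  have h2 : (φ '' (D.nbr b v ∩ X)).encard ≤ (D.nbr b v ∩ X).encard := Set.encard_image_le _ _
  have h3 : L b v = φ '' (D.nbr b v ∩ X) :=
    ((Set.toFinite _).subset h1).eq_of_subset_of_encard_le h1 (h2.trans (h.1 v hv b))
  exact ⟨h3, (Set.toFinite _).injOn_of_encard_image_eq (h2.antisymm (h3 ▸ h.1 v hv b))⟩

/-- Giving `v` a color missing from `L c u` lowers the `c`-degree of `u` in the connected set `X \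
{v}` but leaves its `c`-list intact, against tightness there. -/
theorem Nonsep.subset_of_mem_nbr [Finite V] (hD : D.Loopless) {X : Set V}
    {L : Bool → V → Set Γ} (hX : D.Nonsep X) (h : D.BadOn X L) {u v : V} (hu : u ∈ X) (hv : v ∈ X)
    {c : Bool} (huv : v ∈ D.nbr c u) (b : Bool) : L b v ⊆ L c u := by
  intro α hα
  by_contra hα'
  have hne : u ≠ v := (hD.ne_of_mem_nbr huv).symm
  have hbad := h.residual (Q := {v}) (by simpa) (φ := fun _ => α)
    (isColoringOn_singleton hD (b := b) hα)
  have h1 := hbad.encard_eq hD (hX.2.2 v hv) (v := u) ⟨hu, hne⟩ c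
  have h2 : D.residual L (fun _ => α) {v} c u = L c u := by
    refine sdiff_eq_left.mpr (Set.disjoint_left.mpr fun γ hγ hγ' => ?_)
    obtain ⟨_, _, rfl⟩ := hγ'
    exact hα' hγ
  have h3 := h.1 u hu c
  rw [← h2, h1] at h3
  refine h3.not_gt ((Set.toFinite _).encard_lt_encard ⟨fun w hw => ⟨hw.1, hw.2.1⟩, fun h' => ?_⟩)
  exact (h' ⟨huv, hv⟩).2.2 rfl

theorem ConnOn.const {X : Set V} (hX : D.ConnOn X) {β : Type*} {f : V → β}
    (h : ∀ u ∈ X, ∀ v ∈ X, ∀ b, v ∈ D.nbr b u → f v = f u) {u v : V} (hu : u ∈ X) (hv : v ∈ X) :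
    f v = f u := by
  by_contra hne
  obtain ⟨a, ha, c, hc, b, hb⟩ := hX {w ∈ X | f w = f u} (Set.sep_subset _ _) ⟨u, hu, rfl⟩
    ⟨v, hv, fun h' => hne h'.2⟩
  exact hc.2 ⟨hc.1, (h a ha.1 c hc.1 b hb).trans ha.2⟩

/-- In a bad block the lists are uniform. -/
theorem Nonsep.exists_const [Finite V] (hD : D.Loopless) {X : Set V}
    {L : Bool → V → Set Γ} (hX : D.Nonsep X) (h : D.BadOn X L) :
    ∃ K : Set Γ, ∀ u ∈ X, ∀ c, L c u = K ∨ (L c u = ∅ ∧ D.nbr c u ∩ X = ∅) := by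
  obtain ⟨x, hx⟩ := hX.1
  -- Comparing lists along the arc from both ends, `L c u` contains both lists of `v` and, through
  -- `L (!c) v`, both lists of `u`.
  have key : ∀ u ∈ X, ∀ v ∈ X, ∀ c, v ∈ D.nbr c u →
      L c u = (⋃ b, L b u) ∧ L c u = ⋃ b, L b v := by
    intro u hu v hv c huv
    have h1 := hX.subset_of_mem_nbr hD h hu hv huv
    have h2 := hX.subset_of_mem_nbr hD h hv hu (c := !c) (mem_nbr_not.mpr huv)
    refine ⟨(Set.subset_iUnion (fun b => L b u) c).antisymm (Set.iUnion_subset fun b => ?_),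
      Set.Subset.antisymm ?_ (Set.iUnion_subset h1)⟩
    · exact (h2 b).trans (h1 _)
    · exact (h2 c).trans (Set.subset_iUnion (fun b => L b v) (!c))
  refine ⟨⋃ b, L b x, fun u hu c => ?_⟩
  rcases (D.nbr c u ∩ X).eq_empty_or_nonempty with h0 | ⟨v, hv, hvX⟩
  · right
    refine ⟨?_, h0⟩
    rw [← Set.encard_eq_zero, h.encard_eq hD hX.2.1 hu c, h0, Set.encard_empty]
  · left
    rw [(key u hu v hvX c hv).1]
    exact hX.2.1.const (f := fun u => ⋃ b, L b u)
      (fun u hu v hv b hb => (key u hu v hv b hb).2.symm.trans (key u hu v hv b hb).1) hx hu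

end Digraph

/-! ### End blocks and deletion of a vertex from a bad block. -/

namespace Digraph

variable {V Γ : Type*} {D : Digraph V}

theorem connOn_of_notMem {X : Set V} (b : V)
    (h : ∀ A ⊆ X, b ∉ A → A.Nonempty → (X \ A).Nonempty →
      ∃ a ∈ A, ∃ c ∈ X \ A, ∃ b, c ∈ D.nbr b a) : D.ConnOn X := by
  intro A hA hne hne'
  by_cases hb : b ∈ A
  · obtain ⟨a, ha, c, hc, d, hd⟩ := h (X \ A) Set.sdiff_subset (fun h' => h'.2 hb) hne'
      (by rwa [Set.sdiff_sdiff_cancel_left hA])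
    rw [Set.sdiff_sdiff_cancel_left hA] at hc
    exact ⟨c, hc, a, ha, !d, mem_nbr_not.mpr hd⟩
  · exact h A hA hb hne hne'

/-- `A` is a union of components of `Y - x`, neither empty nor everything. -/
structure IsPart (D : Digraph V) (Y : Set V) (x : V) (A : Set V) : Prop where
  mem : x ∈ Y
  subset : A ⊆ Y
  notMem : x ∉ A
  nonempty : A.Nonempty
  nonempty' : (Y \ insert x A).Nonempty
  notMem_nbr : ∀ a ∈ A, ∀ c ∈ Y \ insert x A, ∀ b, c ∉ D.nbr b a

variable {Y A : Set V} {x : V}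

theorem IsPart.sdiff_sdiff (h : D.IsPart Y x A) : Y \ insert x (Y \ insert x A) = A := by
  ext v
  have := h.mem
  have := @h.subset v
  have := h.notMem
  grind

theorem IsPart.compl (h : D.IsPart Y x A) : D.IsPart Y x (Y \ insert x A) where
  mem := h.mem
  subset := Set.sdiff_subset
  notMem h' := h'.2 (Set.mem_insert _ _)
  nonempty := h.nonempty'
  nonempty' := by rw [h.sdiff_sdiff]; exact h.nonempty
  notMem_nbr a ha c hc b hb := by
    rw [h.sdiff_sdiff] at hc
    exact h.notMem_nbr c hc a ha (!b) (mem_nbr_not.mpr hb)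

theorem IsPart.connOn (hY : D.ConnOn Y) (h : D.IsPart Y x A) : D.ConnOn (insert x A) := by
  refine connOn_of_notMem x fun B hB hxB hne _ => ?_
  have hBA : B ⊆ A := fun v hv => (hB hv).resolve_left fun h' => hxB (h' ▸ hv)
  obtain ⟨a, ha, c, hc, b, hb⟩ := hY B (hBA.trans h.subset) hne ⟨x, h.mem, hxB⟩
  refine ⟨a, ha, c, ⟨?_, hc.2⟩, b, hb⟩
  by_contra hcx
  exact h.notMem_nbr a (hBA ha) c ⟨hc.1, hcx⟩ b hb

theorem exists_isPart (hx : x ∈ Y) (h : ¬ D.ConnOn (Y \ {x})) : ∃ A, D.IsPart Y x A := by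
  simp only [ConnOn, not_forall] at h
  obtain ⟨A, hA, hne, hne', h⟩ := h
  have heq : Y \ insert x A = (Y \ {x}) \ A := by
    ext v; simp only [Set.mem_sdiff, Set.mem_insert_iff, Set.mem_singleton_iff]; tauto
  exact ⟨A, hx, fun v hv => (hA hv).1, fun h' => (hA h').2 rfl, hne, heq ▸ hne',
    fun a ha c hc b hb => h ⟨a, ha, c, heq ▸ hc, b, hb⟩⟩

theorem Nonsep.subset_or_subset {Z : Set V} (hZ : D.Nonsep Z) (hZY : Z ⊆ Y)
    (h : D.IsPart Y x A) : Z ⊆ insert x A ∨ Z ⊆ insert x (Y \ insert x A) := by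
  by_contra! hcon
  obtain ⟨⟨p, hp, hp'⟩, q, hq, hq'⟩ := And.imp Set.not_subset.mp Set.not_subset.mp hcon
  have hpx : p ≠ x := fun e => hp' (e ▸ Set.mem_insert _ _)
  have hqx : q ≠ x := fun e => hq' (e ▸ Set.mem_insert _ _)
  have hqA : q ∈ A := by
    have := hZY hq
    grind
  have hc : D.ConnOn (Z \ {x}) := by
    by_cases hxZ : x ∈ Z
    · exact hZ.2.2 x hxZ
    · rw [Set.sdiff_singleton_eq_self hxZ]
      exact hZ.2.1
  obtain ⟨a, ha, c, hc, b, hb⟩ := hc (A ∩ Z) (fun v hv => ⟨hv.2, fun e => h.notMem (e ▸ hv.1)⟩)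
    ⟨q, hqA, hq⟩ ⟨p, ⟨hp, hpx⟩, fun h' => hp' (Set.mem_insert_of_mem _ h'.1)⟩
  refine h.notMem_nbr a ha.1 c ⟨hZY hc.1.1, ?_⟩ b hb
  rintro (h' | h')
  · exact hc.1.2 h'
  · exact hc.2 ⟨h', hc.1.1⟩

/-- Each part contains an end block. -/
theorem IsPart.exists_nonsep [Finite V] (hY : D.ConnOn Y) (h : D.IsPart Y x A) :
    ∃ y, ∃ I ⊆ A, D.IsPart Y y I ∧ D.Nonsep (insert y I) := by
  -- Minimality is over all attachment vertices `y` at once: if deleting `w` disconnects `insert y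
  -- I`, a side avoiding `y` is a smaller part, attached at `w`.
  obtain ⟨I, ⟨hIA, y, hI⟩, hmin⟩ := (Set.toFinite {I : Set V | I ⊆ A ∧ ∃ y, D.IsPart Y y I}).exists_minimal
    ⟨A, subset_rfl, x, h⟩
  refine ⟨y, I, hIA, hI, Set.insert_nonempty _ _, hI.connOn hY, fun w hw => ?_⟩
  refine connOn_of_notMem y fun B hB hyB hne hne' => ?_
  by_contra hcon
  have hBI : B ⊆ I := fun v hv => (hB hv).1.resolve_left fun e => hyB (e ▸ hv)
  have hwB : w ∉ B := fun h' => (hB h').2 rfl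
  have hwY : w ∈ Y := Set.insert_subset hI.mem hI.subset hw
  obtain ⟨p, hp, hpB⟩ := hne'
  have hpart : D.IsPart Y w B := by
    refine ⟨hwY, hBI.trans hI.subset, hwB, hne,
      ⟨p, Set.insert_subset hI.mem hI.subset hp.1, ?_⟩, fun a ha c hc b hb => ?_⟩
    · rintro (h' | h')
      exacts [hp.2 h', hpB h']
    · by_cases hcI : c ∈ insert y I
      · exact hcon ⟨a, ha, c, ⟨⟨hcI, fun e => hc.2 (.inl e)⟩, fun h' => hc.2 (.inr h')⟩, b, hb⟩
      · exact hI.notMem_nbr a (hBI ha) c ⟨hc.1, hcI⟩ b hb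
  have hIB : I ⊆ B := hmin ⟨hBI.trans hIA, w, hpart⟩ hBI
  have hwy : w = y := hw.resolve_right fun h' => hwB (hIB h')
  subst hwy
  exact hpB (hIB (hp.1.resolve_left hp.2))

/-- If `X` is a bad block with constant lists of size at least two and `Y = X - v`, then a
vertex set in `Y` carrying uniform lists and meeting the neighbourhood of `v` is joined to `v` by
arcs in both directions. -/
theorem mem_nbr_of_residual_uniform {K M : Set Γ} (hK : K.Nontrivial) {i : Γ} (hi : i ∈ K) {v : V}
    {S : Set V} (hS : ∀ u ∈ S, ∀ c, D.residual (fun _ _ => K) (fun _ => i) {v} c u = M ∨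
      D.residual (fun _ _ => K) (fun _ => i) {v} c u = ∅)
    (hv : ∃ u ∈ S, ∃ c, v ∈ D.nbr c u) : ∀ u ∈ S, ∀ c, v ∈ D.nbr c u := by
  have h1 : ∀ u c, v ∈ D.nbr c u → D.residual (fun _ _ => K) (fun _ => i) {v} c u = K \ {i} := by
    intro u c h
    have : D.nbr c u ∩ {v} = {v} := by simpa
    simp [residual, this]
  have h2 : ∀ u c, v ∉ D.nbr c u → D.residual (fun _ _ => K) (fun _ => i) {v} c u = K := by
    intro u c h
    have : D.nbr c u ∩ {v} = ∅ := by simpa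
    simp [residual, this]
  obtain ⟨j, hj, hji⟩ := hK.exists_ne i
  obtain ⟨u₀, hu₀, c₀, h₀⟩ := hv
  -- The second color `j` keeps `K \ {i}` nonempty, so it is the uniform list; a list still
  -- containing `i` is then impossible.
  have hM : M = K \ {i} := by
    rcases hS u₀ hu₀ c₀ with h | h
    · rw [← h, h1 _ _ h₀]
    · rw [h1 _ _ h₀] at h
      exact (h.le ⟨hj, hji⟩).elim
  intro u hu c
  by_contra hcu
  rcases hS u hu c with h | h <;> rw [h2 _ _ hcu] at h
  · exact absurd (h.trans hM ▸ hi : i ∈ K \ {i}) fun h' => h'.2 rfl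
  · exact absurd (h ▸ hi) (Set.notMem_empty _)

variable {X : Set V}

theorem Nonsep.mem_nbr_of_sdiff [Finite V] (hD : D.Loopless) {K : Set Γ}
    (hX : D.Nonsep X) (h : D.BadOn X fun _ _ => K) (hK : K.Nontrivial) {v : V} (hv : v ∈ X)
    (hY : D.Nonsep (X \ {v})) : ∀ u ∈ X \ {v}, ∀ c, v ∈ D.nbr c u := by
  obtain ⟨i, hi⟩ := hK.nonempty
  have hbad := h.residual (Q := {v}) (by simpa) (φ := fun _ => i)
    (isColoringOn_singleton hD (b := true) hi)
  obtain ⟨M, hM⟩ := hY.exists_const hD hbad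
  refine mem_nbr_of_residual_uniform hK hi (fun u hu c => (hM u hu c).imp_right And.left) ?_
  obtain ⟨a, ha, c, hc, b, hb⟩ := hX.2.1 (X \ {v}) Set.sdiff_subset hY.1
    ⟨v, hv, fun h => h.2 rfl⟩
  obtain rfl : c = v := by
    by_contra hne
    exact hc.2 ⟨hc.1, hne⟩
  exact ⟨a, ha, b, hb⟩

/-- Color `v`, then greedily everything outside the end block, which stays bad. Vertices of `I` see
none of the greedy part, so uniform lists join `v` both ways to all of `I`. A vertex of `I` is left
with `|K| - 1` colors and at most `|I|` neighbors per direction in the end block. -/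
theorem Nonsep.endblock [Finite V] (hD : D.Loopless) {K : Set Γ}
    (hX : D.Nonsep X) (h : D.BadOn X fun _ _ => K) (hK : K.Nontrivial) {v : V} (hv : v ∈ X)
    {y : V} {I : Set V} (hI : D.IsPart (X \ {v}) y I) (hB : D.Nonsep (insert y I)) :
    (∀ u ∈ I, ∀ c, v ∈ D.nbr c u) ∧ K.encard ≤ I.encard + 1 := by
  obtain ⟨i, hi⟩ := hK.nonempty
  have : Nonempty Γ := ⟨i⟩
  have hbad := h.residual (Q := {v}) (by simpa) (φ := fun _ => i)
    (isColoringOn_singleton hD (b := true) hi)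
  set Y := X \ {v}
  set L := D.residual (fun _ _ => K) (fun _ => i) {v}
  set Q := Y \ insert y I
  have hsub : insert y I ⊆ Y := Set.insert_subset hI.mem hI.subset
  obtain ⟨φ, hφ⟩ := (hX.2.2 v hv).exists_isColoringOn hD hbad.1 (S := Q)
    ⟨Set.sdiff_subset, fun h' => (h' hI.mem).2 (Set.mem_insert _ _)⟩
  have hbad' := hbad.residual Set.sdiff_subset hφ
  rw [show Y \ Q = insert y I from Set.sdiff_sdiff_cancel_left hsub] at hbad'
  obtain ⟨M, hM⟩ := hB.exists_const hD hbad'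
  have hres : ∀ u ∈ I, ∀ c, D.residual L φ Q c u = L c u := by
    intro u hu c
    have : D.nbr c u ∩ Q = ∅ := by
      rw [← Set.disjoint_iff_inter_eq_empty, Set.disjoint_right]
      exact fun w hw => hI.notMem_nbr u hu w hw c
    simp [residual, this]
  have hall : ∀ u ∈ I, ∀ c, v ∈ D.nbr c u := by
    refine mem_nbr_of_residual_uniform (M := M) hK hi (fun u hu c => ?_) ?_
    · rw [show D.residual (fun _ _ => K) (fun _ => i) {v} = L from rfl, ← hres u hu c]
      exact (hM u (Set.mem_insert_of_mem _ hu) c).imp_right And.left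
    · obtain ⟨a, ha, c, hc, b, hb⟩ := hX.2.2 y hI.mem.1 I
        (fun u hu => ⟨(hI.subset hu).1, fun e => hI.notMem (e ▸ hu)⟩) hI.nonempty
        ⟨v, ⟨hv, fun e => hI.mem.2 e.symm⟩, fun h' => (hI.subset h').2 rfl⟩
      have hcv : c = v := by
        by_contra hne
        refine hI.notMem_nbr a ha c ⟨⟨hc.1.1, hne⟩, ?_⟩ b hb
        rintro (h' | h')
        exacts [hc.1.2 h', hc.2 h']
      exact ⟨a, ha, b, hcv ▸ hb⟩
  refine ⟨hall, ?_⟩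
  obtain ⟨u, hu⟩ := hI.nonempty
  have h1 := hbad'.encard_eq hD hB.2.1 (v := u) (Set.mem_insert_of_mem _ hu) true
  rw [hres u hu] at h1
  have h2 : L true u = K \ {i} := by
    have : D.nbr true u ∩ {v} = {v} := by simpa using hall u hu true
    simp [L, residual, this]
  rw [h2] at h1
  have h3 : D.nbr true u ∩ insert y I ⊆ insert y (I \ {u}) := by
    rintro w ⟨hw, rfl | hwI⟩
    · exact Set.mem_insert _ _
    · exact Set.mem_insert_of_mem _ ⟨hwI, hD.ne_of_mem_nbr hw⟩
  calc K.encard ≤ (K \ {i}).encard + 1 := by rw [Set.encard_sdiff_singleton_add_one hi]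
    _ ≤ ((I \ {u}).encard + 1) + 1 := by
        rw [h1]
        gcongr
        exact (Set.encard_le_encard h3).trans (Set.encard_insert_le _ _)
    _ = I.encard + 1 := by rw [Set.encard_sdiff_singleton_add_one hu]

/-- If no vertex deletion leaves a block, then the digraph is bidirected and 2-regular. -/
theorem Nonsep.symm_of_not_nonsep [Finite V] (hD : D.Loopless) {K : Set Γ}
    (hX : D.Nonsep X) (h : D.BadOn X fun _ _ => K) (hK : K.Nontrivial) {v : V} (hv : v ∈ X)
    (hY : ¬ D.Nonsep (X \ {v})) :
    K.encard = 2 ∧ D.nbr true v ∩ X = D.nbr false v ∩ X := by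
  have hdeg : ∀ b, K.encard = (D.nbr b v ∩ X).encard := h.encard_eq hD hX.2.1 hv
  have hne : (X \ {v}).Nonempty := by
    have : (D.nbr true v ∩ X).Nonempty := by
      rw [← Set.encard_ne_zero, ← hdeg true, Set.encard_ne_zero]
      exact hK.nonempty
    obtain ⟨w, hw, hwX⟩ := this
    exact ⟨w, hwX, hD.ne_of_mem_nbr hw⟩
  have hconn := hX.2.2 v hv
  have : ∃ x ∈ X \ {v}, ¬ D.ConnOn ((X \ {v}) \ {x}) := by
    by_contra! hcon
    exact hY ⟨hne, hconn, hcon⟩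
  obtain ⟨x, hx, hxc⟩ := this
  obtain ⟨A, hA⟩ := exists_isPart hx hxc
  obtain ⟨y₁, I₁, hIA₁, hI₁, hB₁⟩ := hA.exists_nonsep hconn
  obtain ⟨y₂, I₂, hIA₂, hI₂, hB₂⟩ := hA.compl.exists_nonsep hconn
  obtain ⟨hv₁, hc₁⟩ := hX.endblock hD h hK hv hI₁ hB₁
  obtain ⟨hv₂, hc₂⟩ := hX.endblock hD h hK hv hI₂ hB₂
  have hdisj : Disjoint I₁ I₂ := Set.disjoint_left.mpr fun u h1 h2 =>
    (hIA₂ h2).2 (Set.mem_insert_of_mem _ (hIA₁ h1))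
  have hsub : ∀ b, I₁ ∪ I₂ ⊆ D.nbr b v ∩ X := by
    rintro b u (hu | hu)
    · exact ⟨by simpa using mem_nbr_not.mpr (hv₁ u hu (!b)), (hI₁.subset hu).1⟩
    · exact ⟨by simpa using mem_nbr_not.mpr (hv₂ u hu (!b)), (hI₂.subset hu).1⟩
  have hle : I₁.encard + I₂.encard ≤ K.encard := by
    rw [← Set.encard_union_eq hdisj, hdeg true]
    exact Set.encard_le_encard (hsub true)
  have h2K : 2 ≤ K.encard := by
    have := Set.one_lt_encard_iff_nontrivial.mpr hK
    exact Order.add_one_le_of_lt this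
  have hn₁ := (Set.toFinite I₁).cast_ncard_eq
  have hn₂ := (Set.toFinite I₂).cast_ncard_eq
  have hn : K.encard = ((D.nbr true v ∩ X).ncard : ℕ∞) := by
    rw [hdeg true, (Set.toFinite _).cast_ncard_eq]
  rw [← hn₁] at hc₁ hle
  rw [← hn₂] at hc₂ hle
  rw [hn] at hc₁ hc₂ hle h2K ⊢
  norm_cast at hc₁ hc₂ hle h2K ⊢
  -- `|K| ≤ |I₁| + 1`, `|K| ≤ |I₂| + 1` and `|I₁| + |I₂| ≤ |K|` give `|K| ≤ 2`; then `I₁ ∪ I₂` fills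
  -- both neighborhoods of `v`.
  refine ⟨by omega, ?_⟩
  have heq : ∀ b, I₁ ∪ I₂ = D.nbr b v ∩ X := by
    intro b
    refine (Set.toFinite _).eq_of_subset_of_encard_le (hsub b) ?_
    rw [← hdeg b, hn, Set.encard_union_eq hdisj, ← hn₁, ← hn₂]
    norm_cast
    omega
  rw [← heq, heq false]

end Digraph

/-! ### Recognizing cycles and complete digraphs. -/

namespace Digraph

variable {V Γ : Type*} {D : Digraph V} {X : Set V}

theorem induced_coe_adj {u w : X} : (D.induced X).coe.Adj u w ↔ D.Adj u w :=
  ⟨fun h => h.1, fun h => ⟨h, u.2, w.2⟩⟩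

theorem isBidirectedComplete_induced (hD : D.Loopless)
    (h : ∀ u ∈ X, ∀ w ∈ X, u ≠ w → D.Adj u w) : (D.induced X).coe.IsBidirectedComplete := by
  refine Digraph.ext ?_
  funext u w
  refine propext ⟨fun h' => ?_, fun h' => ?_⟩
  · rintro rfl
    exact hD _ h'.1
  · exact ⟨h u u.2 w w.2 fun e => h' (Subtype.ext e), u.2, w.2⟩

/-- A transitive cyclic permutation is a rotation. -/
theorem exists_zmod_equiv {W : Type*} [Finite W] (σ : Equiv.Perm W) (x : W)
    (h : ∀ y, ∃ i : ℤ, (σ ^ i) x = y) :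
    ∃ n : ℕ, n ≠ 0 ∧ ∃ e : ZMod n ≃ W, ∀ i, e (i + 1) = σ (e i) := by
  set n := Function.minimalPeriod (σ • ·) x
  let f : ZMod n → W := fun k => ((MulAction.orbitZPowersEquiv σ x).symm k : W)
  have hf : ∀ j : ℤ, f j = (σ ^ j) x := by
    intro j
    exact (congrArg Subtype.val (MulAction.orbitZPowersEquiv_symm_apply' σ x j)).trans rfl
  have hbij : Function.Bijective f := by
    refine ⟨fun a b hab => (MulAction.orbitZPowersEquiv σ x).symm.injective (Subtype.ext hab),
      fun y => ?_⟩
    obtain ⟨i, hi⟩ := h y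
    exact ⟨i, (hf i).trans hi⟩
  refine ⟨n, fun h0 => ?_, Equiv.ofBijective f hbij, fun i => ?_⟩
  -- `ZMod 0` is infinite, so the period is not zero.
  · have := Finite.of_injective f hbij.1
    rw [h0] at this
    exact not_finite (ZMod 0)
  · obtain ⟨j, rfl⟩ := ZMod.intCast_surjective i
    have : f ((j + 1 : ℤ) : ZMod n) = σ (f j) := by
      rw [hf, hf, add_comm, zpow_add, zpow_one, Equiv.Perm.mul_apply]
    simpa using this

/-- The out-neighbor map is a permutation with the in-neighbor map as inverse. Its orbits are closed
under arcs in both directions, so connectedness leaves one orbit. -/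
theorem ConnOn.isDirectedCycle [Finite V] (hD : D.Loopless) (hX : D.ConnOn X)
    (hne : X.Nonempty) (h : ∀ v ∈ X, ∀ b, (D.nbr b v ∩ X).encard = 1) :
    (D.induced X).coe.IsDirectedCycle := by
  have key : ∀ v : X, ∀ b, ∃ w : X, D.nbr b v ∩ X = {(w : V)} := by
    intro v b
    obtain ⟨w, hw⟩ := Set.encard_eq_one.mp (h v v.2 b)
    exact ⟨⟨w, (hw.ge rfl).2⟩, hw⟩
  choose g hg using key
  have hmem : ∀ (v : X) b, (g v b : V) ∈ D.nbr b v := fun v b => ((hg v b).ge rfl).1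
  have hinv : ∀ (v : X) b, g (g v b) (!b) = v := fun v b => Subtype.ext
    ((hg (g v b) (!b)).le ⟨mem_nbr_not.mpr (hmem v b), v.2⟩ : (v : V) = _).symm
  let σ : Equiv.Perm X := ⟨fun v => g v true, fun v => g v false, fun v => hinv v true,
    fun v => hinv v false⟩
  have hadj : ∀ u w : X, D.Adj u w ↔ w = σ u := fun u w =>
    ⟨fun h' => Subtype.ext ((hg u true).le ⟨h', w.2⟩), fun h' => h' ▸ hmem u true⟩
  obtain ⟨x, hx⟩ := hne
  have horb : ∀ y, ∃ i : ℤ, (σ ^ i) ⟨x, hx⟩ = y := by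
    intro y
    have hstep : ∀ u w : X, D.Adj u w →
        ((∃ i : ℤ, (σ ^ i) ⟨x, hx⟩ = w) ↔ ∃ i : ℤ, (σ ^ i) ⟨x, hx⟩ = u) := by
      intro u w huw
      rw [(hadj u w).mp huw]
      constructor
      · rintro ⟨i, hi⟩
        refine ⟨-1 + i, ?_⟩
        rw [zpow_add, Equiv.Perm.mul_apply, hi, zpow_neg_one]
        exact σ.symm_apply_apply u
      · rintro ⟨i, hi⟩
        refine ⟨1 + i, ?_⟩
        rw [zpow_add, Equiv.Perm.mul_apply, hi, zpow_one]
    have := hX.const (f := fun v => ∃ hv : v ∈ X, ∃ i : ℤ, (σ ^ i) ⟨x, hx⟩ = ⟨v, hv⟩)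
      (fun u hu v hv b hb => by
        simp only [hu, hv, exists_true_left]
        cases b
        · exact propext (hstep ⟨v, hv⟩ ⟨u, hu⟩ hb).symm
        · exact propext (hstep ⟨u, hu⟩ ⟨v, hv⟩ hb)) hx y.2
    exact (this.mpr ⟨hx, 0, rfl⟩).2
  obtain ⟨n, hn, e, he⟩ := exists_zmod_equiv σ ⟨x, hx⟩ horb
  have hrel : ∀ u w : X, e.symm w = e.symm u + 1 ↔ D.Adj u w := fun u w => by
    rw [hadj, Equiv.symm_apply_eq, he, Equiv.apply_symm_apply]
  refine ⟨n, ?_, ⟨⟨e.symm, fun {u w} => ?_⟩⟩⟩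
  -- Period one would make `e 0` its own out-neighbor.
  · by_contra hlt
    obtain rfl : n = 1 := by omega
    refine hD _ ((hadj (e 0) (e 0)).mpr ?_)
    rw [← he]
    congr
  · exact (hrel u w).trans induced_coe_adj.symm

/-- A cycle in a 2-regular graph uses both edges at each of its vertices, so it is closed under
adjacency and, by connectedness, is everything. -/
theorem ConnOn.exists_cycleGraph_iso [Finite V] (hX : D.ConnOn X) (hne : X.Nonempty)
    (G : SimpleGraph X) (hG : ∀ u w : X, ∀ b, (w : V) ∈ D.nbr b u ↔ G.Adj u w)
    (h : ∀ v, (G.neighborSet v).ncard = 2) :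
    ∃ n, 3 ≤ n ∧ Nonempty (G ≃g SimpleGraph.cycleGraph n) := by
  obtain ⟨x, hx⟩ := hne
  have hcyc : G.IsCycles := fun v _ => h v
  obtain ⟨p, hp, -⟩ := hcyc.exists_cycle_toSubgraph_verts_eq_connectedComponentSupp
    (c := G.connectedComponentMk ⟨x, hx⟩) (v := ⟨x, hx⟩) rfl
    (Set.nonempty_of_ncard_ne_zero (by rw [h]; norm_num))
  have h3 := hp.three_le_length
  obtain ⟨f⟩ := (SimpleGraph.cycleGraph_isContained_iff h3).mpr ⟨_, p, hp, rfl⟩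
  generalize p.length = n at h3 f
  have hnb : ∀ i, f '' ((SimpleGraph.cycleGraph n).neighborSet i) = G.neighborSet (f i) := by
    intro i
    refine Set.eq_of_subset_of_ncard_le ?_ ?_ (Set.toFinite _)
    · rintro _ ⟨j, hj, rfl⟩
      exact f.toHom.map_adj hj
    · rw [h, show (f '' _).ncard = _ from Set.ncard_image_of_injective _ f.injective]
      obtain ⟨m, rfl⟩ : ∃ m, n = m + 3 := ⟨n - 3, by omega⟩
      have := SimpleGraph.cycleGraph_degree_three_le (v := i)
      rw [← SimpleGraph.card_neighborSet_eq_degree, ← Nat.card_eq_fintype_card] at this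
      rw [← Nat.card_coe_set_eq, this]
  have hrange : ∀ u w, G.Adj u w → u ∈ Set.range f → w ∈ Set.range f := by
    rintro _ w hw ⟨i, rfl⟩
    have : w ∈ G.neighborSet (f i) := hw
    rw [← hnb] at this
    exact Set.image_subset_range _ _ this
  have hsurj : Function.Surjective f := by
    intro y
    have := hX.const (f := fun v => ∃ hv : v ∈ X, (⟨v, hv⟩ : X) ∈ Set.range f)
      (fun u hu v hv b hb => by
        simp only [hu, hv, exists_true_left]
        have := (hG ⟨u, hu⟩ ⟨v, hv⟩ b).mp hb
        exact propext ⟨hrange _ _ this.symm, hrange _ _ this⟩) (f ⟨0, by omega⟩).2 y.2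
    exact (this.mpr ⟨Subtype.coe_prop _, _, rfl⟩).2
  refine ⟨n, h3, ⟨SimpleGraph.Iso.symm ⟨Equiv.ofBijective f ⟨f.injective, hsurj⟩, ?_⟩⟩⟩
  intro i j
  refine ⟨fun hij => ?_, fun hij => f.toHom.map_adj hij⟩
  have : f j ∈ G.neighborSet (f i) := hij
  rw [← hnb] at this
  obtain ⟨j', hj', he⟩ := this
  exact f.injective he ▸ hj'

theorem Nonsep.shape_of_symm [Finite V] (hD : D.Loopless) {K : Set Γ} (hX : D.Nonsep X)
    (h : D.BadOn X fun _ _ => K) (hK : K.encard = 2)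
    (hs : ∀ v ∈ X, D.nbr true v ∩ X = D.nbr false v ∩ X) :
    (D.induced X).coe.IsBidirectedComplete ∨ (D.induced X).coe.IsBidirectedLongOddCycle := by
  obtain ⟨α, β, hαβ, rfl⟩ := Set.encard_eq_two.mp hK
  have hsym : ∀ u ∈ X, ∀ w ∈ X, D.Adj u w ↔ D.Adj w u := fun u hu w hw =>
    ⟨fun h' => ((hs u hu).le ⟨h', hw⟩).1, fun h' => ((hs u hu).ge ⟨h', hw⟩).1⟩
  let G : SimpleGraph X :=
    { Adj := fun u w => D.Adj u w
      symm := ⟨fun u w => (hsym u u.2 w w.2).mp⟩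
      loopless := ⟨fun u => hD u⟩ }
  have hG : ∀ u w : X, ∀ b, (w : V) ∈ D.nbr b u ↔ G.Adj u w := by
    intro u w b
    cases b
    · exact hsym w w.2 u u.2
    · rfl
  have hdeg : ∀ v, (G.neighborSet v).ncard = 2 := by
    intro v
    have h1 := h.encard_eq hD hX.2.1 v.2 true
    rw [hK] at h1
    have h2 : (Subtype.val '' G.neighborSet v) = D.nbr true v ∩ X := by
      ext w
      constructor
      · rintro ⟨w, hw, rfl⟩
        exact ⟨hw, w.2⟩
      · exact fun hw => ⟨⟨w, hw.2⟩, hw.1, rfl⟩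
    rw [← Set.ncard_image_of_injective _ Subtype.val_injective, h2, Set.ncard_def, ← h1]
    rfl
  obtain ⟨n, hn, ⟨e⟩⟩ := hX.2.1.exists_cycleGraph_iso hX.1 G hG hdeg
  rcases Nat.even_or_odd n with heven | hodd
  -- The proper 2-coloring of an even cycle by `α` and `β` leaves no arc inside a monochromatic set,
  -- so each vertex of such a set is a sink.
  · exfalso
    classical
    let c := SimpleGraph.cycleGraph.bicoloring_of_even n heven
    refine h.2 ⟨fun v => if hv : v ∈ X then (if c (e ⟨v, hv⟩) then α else β) else α, ?_⟩
    intro T hT ⟨v, hv⟩ γ hγ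
    refine ⟨v, hv, true, ?_, fun w hw hwv => ?_⟩
    · rw [← hγ v hv]
      dsimp only
      split_ifs <;> simp
    · have h1 := (hγ v hv).trans (hγ w hw).symm
      have h2 : c (e ⟨v, hT hv⟩) ≠ c (e ⟨w, hT hw⟩) :=
        c.valid (e.map_rel_iff.mpr ((hG ⟨v, hT hv⟩ ⟨w, hT hw⟩ true).mp hwv))
      simp only [hT hv, hT hw, dite_true] at h1
      cases h3 : c (e ⟨v, hT hv⟩) <;> cases h4 : c (e ⟨w, hT hw⟩) <;> simp_all
  · by_cases h3 : n = 3
    · left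
      subst h3
      refine isBidirectedComplete_induced hD fun u hu w hw huw => ?_
      have : (SimpleGraph.cycleGraph 3).Adj (e ⟨u, hu⟩) (e ⟨w, hw⟩) := by
        refine SimpleGraph.cycleGraph_three_eq_top.ge ?_
        exact fun h' => huw (congrArg Subtype.val (e.injective h'))
      exact e.map_rel_iff.mp this
    · right
      refine ⟨n, ?_, hodd, ⟨⟨e.toEquiv, fun {u w} => ?_⟩⟩⟩
      · obtain ⟨k, rfl⟩ := hodd
        omega
      · exact e.map_rel_iff.trans induced_coe_adj.symm

/-- The directed analogue of Brooks' theorem for blocks. -/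
theorem Nonsep.shape [Finite V] (hD : D.Loopless) {K : Set Γ} (hX : D.Nonsep X)
    (h : D.BadOn X fun _ _ => K) :
    (D.induced X).coe.IsDirectedCycle ∨ (D.induced X).coe.IsBidirectedComplete ∨
      (D.induced X).coe.IsBidirectedLongOddCycle := by
  have hdeg : ∀ v ∈ X, ∀ b, (D.nbr b v ∩ X).encard = K.encard :=
    fun v hv b => (h.encard_eq hD hX.2.1 hv b).symm
  rcases K.subsingleton_or_nontrivial with hK | hK
  · rcases hK.eq_empty_or_singleton with rfl | ⟨α, rfl⟩
    -- Empty lists mean no arcs, so `X` is a single vertex.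
    · right; left
      refine isBidirectedComplete_induced hD fun u hu w hw huw => (huw ?_).elim
      refine hX.2.1.const (f := id) (fun u hu v hv b hb => ?_) hw hu
      have := hdeg u hu b
      rw [Set.encard_empty, Set.encard_eq_zero] at this
      exact (this.le ⟨hb, hv⟩).elim
    · left
      exact hX.2.1.isDirectedCycle hD hX.1 (by simpa using hdeg)
  · right
    by_cases hY : ∃ v ∈ X, D.Nonsep (X \ {v})
    · left
      obtain ⟨v, hv, hY⟩ := hY
      have hall := hX.mem_nbr_of_sdiff hD h hK hv hY
      have hv' : D.nbr true v ∩ X = X \ {v} := by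
        refine Set.Subset.antisymm (fun w hw => ⟨hw.2, hD.ne_of_mem_nbr hw.1⟩) fun w hw =>
          ⟨mem_nbr_not.mpr (hall w hw false), hw.1⟩
      -- All out-degrees equal that of `v`, namely `|X| - 1`.
      refine isBidirectedComplete_induced hD fun u hu w hw huw => ?_
      have hsub : D.nbr true u ∩ X ⊆ X \ {u} := fun w hw => ⟨hw.2, hD.ne_of_mem_nbr hw.1⟩
      have hcard : (X \ {u}).encard = (X \ {v}).encard := by
        rw [Set.encard_sdiff_singleton_of_mem hu, Set.encard_sdiff_singleton_of_mem hv]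
      have heq := (Set.toFinite _).eq_of_subset_of_encard_le hsub
        (by rw [hcard, ← hv', hdeg u hu, hdeg v hv])
      exact (heq.ge ⟨hw, huw.symm⟩).1
    · push Not at hY
      obtain ⟨x, hx⟩ := hX.1
      exact hX.shape_of_symm hD h (hX.symm_of_not_nonsep hD h hK hx (hY x hx)).1
        fun v hv => (hX.symm_of_not_nonsep hD h hK hv (hY v hv)).2

end Digraph

/-! ### Splitting a bad set at a separating vertex. -/

namespace Digraph

variable {V Γ : Type*} {D : Digraph V} {X A : Set V} {x : V}

/-- A monochromatic set contains a sink and a source. -/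
theorem IsColoringOn.exists_disjoint_nbr [Finite V] (hD : D.Loopless) {L : Bool → V → Set Γ}
    {φ : V → Γ} (h : D.IsColoringOn X L φ) {T : Set V} (hT : T ⊆ X) (hne : T.Nonempty) {α : Γ}
    (hα : ∀ v ∈ T, φ v = α) (b : Bool) : ∃ v ∈ T, ∀ w ∈ T, w ∉ D.nbr b v := by
  induction hn : T.ncard generalizing T with
  | zero => exact absurd ((Set.ncard_eq_zero (Set.toFinite _)).mp hn) hne.ne_empty
  | succ n ih =>
    obtain ⟨v, hv, d, -, hd⟩ := h T hT hne α hα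
    by_cases hdb : d = b
    · exact ⟨v, hv, hdb ▸ hd⟩
    obtain rfl : (!b) = d := by cases b <;> cases d <;> simp_all
    -- Here `v` is a `b`-neighbor of nobody in `T`, so removing it does not affect the search.
    rcases (T \ {v}).eq_empty_or_nonempty with h0 | h0
    · refine ⟨v, hv, fun w hw hwv => ?_⟩
      exact (h0.le ⟨hw, hD.ne_of_mem_nbr hwv⟩).elim
    · obtain ⟨w, hw, hw'⟩ := ih (T := T \ {v}) (Set.sdiff_subset.trans hT) h0
        (fun u hu => hα u hu.1) (by rw [Set.ncard_sdiff_singleton_of_mem hv]; omega)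
      refine ⟨w, hw.1, fun u hu huw => ?_⟩
      by_cases huv : u = v
      · subst huv
        exact hd w hw.1 (mem_nbr_not.mpr huw)
      · exact hw' u ⟨hu, huv⟩ huw

variable {L : V → Set Γ} {φ : V → Γ}

theorem IsPart.mem_or (_ : D.IsPart X x A) {v : V} (hv : v ∈ X) :
    v = x ∨ v ∈ A ∨ v ∈ X \ insert x A := by
  by_cases h1 : v = x
  · exact .inl h1
  · by_cases h2 : v ∈ A
    · exact .inr (.inl h2)
    · exact .inr (.inr ⟨hv, fun h' => h'.elim h1 h2⟩)

theorem IsPart.nbr_inter (hD : D.Loopless) (h : D.IsPart X x A) (b : Bool) :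
    D.nbr b x ∩ X = (D.nbr b x ∩ A) ∪ (D.nbr b x ∩ (X \ insert x A)) := by
  ext v
  constructor
  · rintro ⟨hv, hvX⟩
    rcases h.mem_or hvX with rfl | h' | h'
    exacts [(hD.notMem_nbr b _ hv).elim, .inl ⟨hv, h'⟩, .inr ⟨hv, h'⟩]
  · rintro (⟨hv, hvA⟩ | ⟨hv, hvA⟩)
    exacts [⟨hv, h.subset hvA⟩, ⟨hv, hvA.1⟩]

/-- At a separating vertex the list is split between the two sides. -/
theorem IsPart.image_split [Finite V] (hD : D.Loopless) (h : D.IsPart X x A)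
    (hbad : D.BadOn X fun _ => L) (hφ : D.IsColoringOn (X \ {x}) (fun _ => L) φ) (b : Bool) :
    L x = φ '' (D.nbr b x ∩ A) ∪ φ '' (D.nbr b x ∩ (X \ insert x A)) ∧
      Disjoint (φ '' (D.nbr b x ∩ A)) (φ '' (D.nbr b x ∩ (X \ insert x A))) := by
  obtain ⟨h1, h2⟩ := hbad.eq_image hD h.mem hφ b
  refine ⟨by rw [h1, h.nbr_inter hD, Set.image_union], Set.disjoint_left.mpr ?_⟩
  rintro _ ⟨v, ⟨hv, hvA⟩, rfl⟩ ⟨w, ⟨hw, hwA⟩, he⟩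
  obtain rfl := h2 ⟨hw, hwA.1⟩ ⟨hv, h.subset hvA⟩ he
  exact hwA.2 (Set.mem_insert_of_mem _ hvA)

/-- On each side of a separating vertex, the colors of the out-neighbours and of the in-neighbours
agree. -/
theorem IsPart.image_subset_image_not [Finite V] (hD : D.Loopless) (h : D.IsPart X x A)
    (hbad : D.BadOn X fun _ => L) (hφ : D.IsColoringOn (X \ {x}) (fun _ => L) φ) (b : Bool) :
    φ '' (D.nbr b x ∩ A) ⊆ φ '' (D.nbr (!b) x ∩ A) := by
  classical
  intro α hα
  by_contra hα'
  obtain ⟨hL, hdisj⟩ := h.image_split hD hbad hφ b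
  have hαL : α ∈ L x := hL ▸ .inl hα
  have hα'' := Set.disjoint_left.mp hdisj hα
  -- Color `x` with `α`. If `T` misses `A`, then `x` has no `b`-neighbor in `T`. Otherwise some
  -- vertex of `T ∩ A` has none in `T ∩ A`, and `x` is not its `b`-neighbor because no `!b`-neighbor
  -- of `x` in `A` has color `α`.
  refine hbad.2 ⟨Function.update φ x α, fun T hT hne γ hγ => ?_⟩
  by_cases hxT : x ∈ T
  swap
  · refine hφ T (fun v hv => ⟨hT hv, fun e => hxT (e ▸ hv)⟩) hne γ fun v hv => ?_
    rw [← hγ v hv, Function.update_of_ne]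
    rintro rfl
    exact hxT hv
  obtain rfl : α = γ := by rw [← hγ x hxT, Function.update_self]
  have hcol : ∀ v ∈ T, v ≠ x → φ v = α := fun v hv hvx => by
    rw [← hγ v hv, Function.update_of_ne hvx]
  have hAx : ∀ v ∈ A, v ≠ x := fun v hv e => h.notMem (e ▸ hv)
  rcases (T ∩ A).eq_empty_or_nonempty with h0 | h0
  · refine ⟨x, hxT, b, hαL, fun w hw hwx => ?_⟩
    rcases h.mem_or (hT hw) with rfl | h' | h'
    · exact hD.notMem_nbr b _ hwx
    · exact h0.le ⟨hw, h'⟩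
    · exact hα'' ⟨w, ⟨hwx, h'⟩, hcol w hw (hD.ne_of_mem_nbr hwx)⟩
  · have hsub : T ∩ A ⊆ X \ {x} := fun v hv => ⟨hT hv.1, hAx v hv.2⟩
    obtain ⟨v, hv, hvT⟩ := hφ.exists_disjoint_nbr hD hsub h0
      (fun v hv => hcol v hv.1 (hAx v hv.2)) b
    have hφv := hcol v hv.1 (hAx v hv.2)
    obtain ⟨-, hmem⟩ := hφ.exists_mem (hsub hv)
    refine ⟨v, hv.1, b, hφv ▸ hmem, fun w hw hwv => ?_⟩
    rcases h.mem_or (hT hw) with rfl | h' | h'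
    · exact hα' ⟨v, ⟨mem_nbr_not.mpr hwv, hv.2⟩, hφv⟩
    · exact hvT w ⟨hw, h'⟩ hwv
    · exact h.notMem_nbr v hv.2 w h' b hwv

/-- Coloring the other side leaves at `x` exactly the colors on its `b`-neighbors in `A`. These do
not depend on `b`, so in-lists and out-lists stay equal and induction remains possible. -/
theorem IsPart.badOn [Finite V] [DecidableEq V] (hD : D.Loopless) (h : D.IsPart X x A)
    (hbad : D.BadOn X fun _ => L) (hφ : D.IsColoringOn (X \ {x}) (fun _ => L) φ) :
    D.BadOn (insert x A) fun _ => Function.update L x (φ '' (D.nbr true x ∩ A)) := by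
  have hb : ∀ b, φ '' (D.nbr b x ∩ A) = φ '' (D.nbr true x ∩ A) := by
    have h1 := h.image_subset_image_not hD hbad hφ true
    have h2 := h.image_subset_image_not hD hbad hφ false
    rintro (_ | _)
    exacts [h2.antisymm h1, rfl]
  have hres := hbad.residual (Q := X \ insert x A) Set.sdiff_subset
    (hφ.mono fun v hv => ⟨hv.1, fun e => hv.2 (.inl e)⟩)
  rw [Set.sdiff_sdiff_cancel_left (Set.insert_subset h.mem h.subset)] at hres
  refine hres.congr fun v hv b => ?_
  rcases hv with rfl | hv
  · rw [Function.update_self, ← hb b]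
    obtain ⟨h1, h2⟩ := h.image_split hD hbad hφ b
    rw [residual, h1, Set.union_sdiff_right]
    exact h2.sdiff_eq_left
  · have hvx : v ≠ x := fun e => h.notMem (e ▸ hv)
    rw [Function.update_of_ne hvx]
    have : D.nbr b v ∩ (X \ insert x A) = ∅ := by
      rw [← Set.disjoint_iff_inter_eq_empty, Set.disjoint_right]
      exact fun w hw => h.notMem_nbr v hv w hw b
    simp [residual, this]

/-! ### Blocks as vertex sets, and their color sets. -/

/-- The vertex sets of the blocks of the subdigraph induced by `X`. -/
def IsBlockSet (D : Digraph V) (X Y : Set V) : Prop :=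
  Maximal (fun Z => Z ⊆ X ∧ D.Nonsep Z) Y

theorem Nonsep.isBlockSet_iff (hX : D.Nonsep X) {Y : Set V} : D.IsBlockSet X Y ↔ Y = X :=
  ⟨fun h => h.1.1.antisymm (h.2 ⟨subset_rfl, hX⟩ h.1.1), by
    rintro rfl
    exact ⟨⟨subset_rfl, hX⟩, fun Z hZ _ => hZ.1⟩⟩

theorem nonsep_pair {u v : V} {b : Bool} (h : v ∈ D.nbr b u) : D.Nonsep {u, v} := by
  have hsub : ∀ w, D.ConnOn {w} := fun w => by
    intro B hB ⟨p, hp⟩ ⟨q, hq, hqB⟩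
    obtain rfl : p = w := hB hp
    obtain rfl : q = p := hq
    exact (hqB hp).elim
  refine ⟨Set.insert_nonempty _ _, connOn_of_notMem v fun B hB hvB ⟨p, hp⟩ _ => ?_, fun w hw => ?_⟩
  · obtain rfl : p = u := (hB hp).resolve_right fun e => hvB (e ▸ hp)
    exact ⟨p, hp, v, ⟨.inr rfl, hvB⟩, b, h⟩
  · by_cases huv : u = v
    · subst huv
      rw [Set.pair_eq_singleton] at hw ⊢
      obtain rfl : w = u := hw
      rw [Set.sdiff_self]
      exact fun B hB hne => absurd (hne.mono hB) (by simp)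
    · rcases hw with rfl | rfl
      · rw [Set.pair_sdiff_left huv]
        exact hsub v
      · rw [Set.pair_sdiff_right huv]
        exact hsub u

/-- Such a `Y` would be `{x}`, but `x` has a neighbor in `A`, and the pair is a larger nonseparable
set. -/
theorem IsPart.not_subset_of_isBlockSet (hX : D.ConnOn X) (h : D.IsPart X x A) {Y : Set V}
    (hY : D.IsBlockSet (insert x A) Y) : ¬ Y ⊆ insert x (X \ insert x A) := by
  intro hsub
  have hYx : Y ⊆ {x} := by
    intro v hv
    rcases hsub hv with h' | h'
    exacts [h', absurd (hY.1.1 hv) h'.2]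
  obtain rfl := (hY.1.2.1.subset_singleton_iff).mp hYx
  obtain ⟨a, ha, c, hc, b, hb⟩ := h.connOn hX {x} (by simp) (by simp)
    (h.nonempty.mono fun v hv => ⟨.inr hv, fun e => h.notMem (e ▸ hv)⟩)
  obtain rfl : a = x := ha
  have := hY.2 ⟨Set.insert_subset (.inl rfl) (Set.singleton_subset_iff.mpr hc.1), nonsep_pair hb⟩
    (by simp)
  exact hc.2 (this (by simp))

theorem IsPart.isBlockSet (hX : D.ConnOn X) (h : D.IsPart X x A) {Y : Set V}
    (hY : D.IsBlockSet (insert x A) Y) : D.IsBlockSet X Y := by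
  have hsub := Set.insert_subset h.mem h.subset
  refine ⟨⟨hY.1.1.trans hsub, hY.1.2⟩, fun Z hZ hYZ => ?_⟩
  rcases hZ.2.subset_or_subset hZ.1 h with h' | h'
  · exact hY.2 ⟨h', hZ.2⟩ hYZ
  · exact (h.not_subset_of_isBlockSet hX hY (hYZ.trans h')).elim

theorem IsPart.isBlockSet_of_subset (h : D.IsPart X x A) {Y : Set V} (hY : D.IsBlockSet X Y)
    (hYA : Y ⊆ insert x A) : D.IsBlockSet (insert x A) Y :=
  ⟨⟨hYA, hY.1.2⟩, fun _ hZ => hY.2 ⟨hZ.1.trans (Set.insert_subset h.mem h.subset), hZ.2⟩⟩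

theorem IsPart.isBlockSet_iff (hX : D.ConnOn X) (h : D.IsPart X x A) {Y : Set V} :
    D.IsBlockSet X Y ↔
      D.IsBlockSet (insert x A) Y ∨ D.IsBlockSet (insert x (X \ insert x A)) Y := by
  refine ⟨fun hY => ?_, fun hY => hY.elim (h.isBlockSet hX) (h.compl.isBlockSet hX)⟩
  exact (hY.1.2.subset_or_subset hY.1.1 h).imp (h.isBlockSet_of_subset hY)
    (h.compl.isBlockSet_of_subset hY)

/-- The list at `v` is the disjoint union of the color sets of the blocks at `v`. -/
def Splits (D : Digraph V) (X : Set V) (L : V → Set Γ) (C : Set V → Set Γ) : Prop :=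
  ∀ v ∈ X, {Y | D.IsBlockSet X Y ∧ v ∈ Y}.PairwiseDisjoint C ∧
    L v = ⋃ Y ∈ {Y | D.IsBlockSet X Y ∧ v ∈ Y}, C Y

theorem Nonsep.splits (hX : D.Nonsep X) {K : Set Γ} (hL : ∀ v ∈ X, L v = K) :
    D.Splits X L fun _ => K := by
  intro v hv
  have : {Y | D.IsBlockSet X Y ∧ v ∈ Y} = {X} := by
    ext Y
    simp only [hX.isBlockSet_iff, Set.mem_ofPred_eq, Set.mem_singleton_iff]
    exact ⟨fun h => h.1, fun h => ⟨h, h ▸ hv⟩⟩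
  rw [this]
  exact ⟨Set.pairwiseDisjoint_singleton _ _, by simpa using hL v hv⟩

/-- Only `x` lies on both sides, and there the shares `M` and `M'` keep the colors of blocks from
different sides apart. -/
theorem IsPart.splits [DecidableEq V] (hX : D.ConnOn X) (h : D.IsPart X x A) {M M' : Set Γ}
    (hL : L x = M ∪ M') (hM : Disjoint M M') {C C₁ C₂ : Set V → Set Γ}
    (h1 : D.Splits (insert x A) (Function.update L x M) C₁)
    (h2 : D.Splits (insert x (X \ insert x A)) (Function.update L x M') C₂)
    (hC₁ : ∀ Y, D.IsBlockSet (insert x A) Y → C Y = C₁ Y)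
    (hC₂ : ∀ Y, D.IsBlockSet (insert x (X \ insert x A)) Y → C Y = C₂ Y) : D.Splits X L C := by
  have h1' : ∀ v ∈ insert x A, {Y | D.IsBlockSet (insert x A) Y ∧ v ∈ Y}.PairwiseDisjoint C ∧
      Function.update L x M v = ⋃ Y ∈ {Y | D.IsBlockSet (insert x A) Y ∧ v ∈ Y}, C Y := by
    intro v hv
    refine ⟨fun Y hY Z hZ hYZ => ?_, ?_⟩
    · have := (h1 v hv).1 hY hZ hYZ
      simpa only [Function.onFun, hC₁ Y hY.1, hC₁ Z hZ.1] using this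
    · rw [(h1 v hv).2]
      exact Set.iUnion₂_congr fun Y hY => (hC₁ Y hY.1).symm
  have h2' : ∀ v ∈ insert x (X \ insert x A),
      {Y | D.IsBlockSet (insert x (X \ insert x A)) Y ∧ v ∈ Y}.PairwiseDisjoint C ∧
      Function.update L x M' v =
        ⋃ Y ∈ {Y | D.IsBlockSet (insert x (X \ insert x A)) Y ∧ v ∈ Y}, C Y := by
    intro v hv
    refine ⟨fun Y hY Z hZ hYZ => ?_, ?_⟩
    · have := (h2 v hv).1 hY hZ hYZ
      simpa only [Function.onFun, hC₂ Y hY.1, hC₂ Z hZ.1] using this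
    · rw [(h2 v hv).2]
      exact Set.iUnion₂_congr fun Y hY => (hC₂ Y hY.1).symm
  have hset : ∀ v, {Y | D.IsBlockSet X Y ∧ v ∈ Y} =
      {Y | D.IsBlockSet (insert x A) Y ∧ v ∈ Y} ∪
        {Y | D.IsBlockSet (insert x (X \ insert x A)) Y ∧ v ∈ Y} := by
    intro v
    ext Y
    simp only [h.isBlockSet_iff hX, Set.mem_ofPred_eq, Set.mem_union, or_and_right]
  intro v hv
  rw [hset]
  rcases h.mem_or hv with rfl | hvA | hvA
  · obtain ⟨p1, q1⟩ := h1' v (.inl rfl)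
    obtain ⟨p2, q2⟩ := h2' v (.inl rfl)
    rw [Function.update_self] at q1 q2
    refine ⟨?_, by rw [Set.biUnion_union, ← q1, ← q2, hL]⟩
    refine Set.pairwiseDisjoint_union.mpr ⟨p1, p2, fun Y hY Z hZ _ => ?_⟩
    refine hM.mono ?_ ?_
    · rw [q1]
      exact Set.subset_biUnion_of_mem hY
    · rw [q2]
      exact Set.subset_biUnion_of_mem hZ
  · have hvx : v ≠ x := fun e => h.notMem (e ▸ hvA)
    have h0 : {Y | D.IsBlockSet (insert x (X \ insert x A)) Y ∧ v ∈ Y} = ∅ := by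
      refine Set.eq_empty_of_forall_notMem fun Y hY => ?_
      rcases hY.1.1.1 hY.2 with h' | h'
      exacts [hvx h', h'.2 (.inr hvA)]
    rw [h0, Set.union_empty, ← Function.update_of_ne hvx M L]
    exact h1' v (.inr hvA)
  · have hvx : v ≠ x := fun e => hvA.2 (.inl e)
    have h0 : {Y | D.IsBlockSet (insert x A) Y ∧ v ∈ Y} = ∅ :=
      Set.eq_empty_of_forall_notMem fun Y hY => hvA.2 (hY.1.1.1 hY.2)
    rw [h0, Set.empty_union, ← Function.update_of_ne hvx M' L]
    exact h2' v (.inr hvA)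

/-- With equal in- and out-lists, an empty list makes both degrees zero, so `X` is one vertex;
otherwise the exception in `Nonsep.exists_const` never occurs. -/
theorem Nonsep.exists_list_eq [Finite V] (hD : D.Loopless) (hX : D.Nonsep X)
    (h : D.BadOn X fun _ => L) : ∃ K : Set Γ, ∀ v ∈ X, L v = K := by
  obtain ⟨K, hK⟩ := hX.exists_const hD h
  by_cases hcon : ∃ u ∈ X, L u = ∅
  · obtain ⟨u, hu, hu0⟩ := hcon
    refine ⟨∅, fun v hv => ?_⟩
    obtain rfl : v = u := by
      by_contra hne
      obtain ⟨a, rfl, c, hc, b, hb⟩ := hX.2.1 {u} (by simpa) (by simp) ⟨v, hv, hne⟩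
      have := h.encard_eq hD hX.2.1 hu b
      rw [hu0, Set.encard_empty] at this
      exact (Set.encard_eq_zero.mp this.symm).le ⟨hb, hc.1⟩
    exact hu0
  · push Not at hcon
    exact ⟨K, fun v hv => (hK v hv true).resolve_right fun h' => (hcon v hv).ne_empty h'.1⟩

/-- The structure of bad pairs, for vertex sets. -/
theorem BadOn.structure [Finite V] (hD : D.Loopless) (hX : D.ConnOn X)
    (hne : X.Nonempty) (h : D.BadOn X fun _ => L) :
    ∃ C : Set V → Set Γ, D.Splits X L C ∧ ∀ Y, D.IsBlockSet X Y →
      ((D.induced Y).coe.IsDirectedCycle ∨ (D.induced Y).coe.IsBidirectedComplete ∨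
        (D.induced Y).coe.IsBidirectedLongOddCycle) ∧
      ∀ v ∈ Y, (D.nbr true v ∩ Y).encard = (C Y).encard := by
  classical
  induction hn : X.ncard using Nat.strong_induction_on generalizing X L with
  | _ n ih =>
  subst hn
  by_cases hsep : D.Nonsep X
  · obtain ⟨K, hK⟩ := hsep.exists_list_eq hD h
    have hbad : D.BadOn X fun _ _ => K := h.congr fun v hv _ => hK v hv
    refine ⟨fun _ => K, hsep.splits hK, fun Y hY => ?_⟩
    obtain rfl := hsep.isBlockSet_iff.mp hY
    exact ⟨hsep.shape hD hbad, fun v hv => (hbad.encard_eq hD hX hv true).symm⟩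
  · have : ∃ x ∈ X, ¬ D.ConnOn (X \ {x}) := by
      by_contra! hcon
      exact hsep ⟨hne, hX, hcon⟩
    obtain ⟨x, hx, hxc⟩ := this
    obtain ⟨A, hA⟩ := exists_isPart hx hxc
    have : Nonempty Γ := by
      obtain ⟨a, ha, c, hc, b, hb⟩ := hX A hA.subset hA.nonempty ⟨x, hA.mem, hA.notMem⟩
      have : (L a).encard ≠ 0 := by
        rw [h.encard_eq hD hX (hA.subset ha) b]
        exact Set.encard_ne_zero_of_mem ⟨hb, hc.1⟩
      exact ⟨(Set.encard_ne_zero.mp this).some⟩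
    obtain ⟨φ, hφ⟩ := hX.exists_isColoringOn hD h.1 (S := X \ {x})
      (Set.sdiff_singleton_ssubset.mpr hx)
    have hlt : ∀ {A}, D.IsPart X x A → (insert x A).ncard < X.ncard := fun hA =>
      Set.ncard_lt_ncard ⟨Set.insert_subset hA.mem hA.subset, fun h' =>
        hA.nonempty'.elim fun v hv => hv.2 (h' hv.1)⟩
    obtain ⟨C₁, hC₁, hC₁'⟩ := ih _ (hlt hA) (hA.connOn hX)
      (Set.insert_nonempty _ _) (hA.badOn hD h hφ) rfl
    obtain ⟨C₂, hC₂, hC₂'⟩ := ih _ (hlt hA.compl) (hA.compl.connOn hX)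
      (Set.insert_nonempty _ _) (hA.compl.badOn hD h hφ) rfl
    obtain ⟨hL, hdisj⟩ := hA.image_split hD h hφ true
    -- A block of the other side is never contained in `insert x A`, so the case distinction picks
    -- the right side.
    let C : Set V → Set Γ := fun Y => if Y ⊆ insert x A then C₁ Y else C₂ Y
    have e₁ : ∀ Y, D.IsBlockSet (insert x A) Y → C Y = C₁ Y := fun Y hY => if_pos hY.1.1
    have e₂ : ∀ Y, D.IsBlockSet (insert x (X \ insert x A)) Y → C Y = C₂ Y := fun Y hY =>
      if_neg fun h' => hA.compl.not_subset_of_isBlockSet hX hY (by rwa [hA.sdiff_sdiff])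
    refine ⟨C, hA.splits hX hL hdisj hC₁ hC₂ e₁ e₂, fun Y hY => ?_⟩
    rcases (hA.isBlockSet_iff hX).mp hY with hY | hY
    · rw [e₁ Y hY]
      exact hC₁' Y hY
    · rw [e₂ Y hY]
      exact hC₂' Y hY

end Digraph

/-! ### From vertex sets back to subdigraphs and list colorings. -/

namespace Digraph

variable {V Γ : Type*} {D : Digraph V} {X : Set V}

/-- The general map `f` serves both a subdigraph and a subdigraph minus a vertex. -/
theorem connOn_of_preconnected {W : Type*} {E : Digraph W} {f : W → V}
    (hf : ∀ a b, E.Adj a b → D.Adj (f a) (f b)) (hr : Set.range f = X)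
    (h : E.underlying.Preconnected) : D.ConnOn X := by
  subst hr
  rintro A hA ⟨a, ha⟩ ⟨_, ⟨q, rfl⟩, hq⟩
  obtain ⟨p, rfl⟩ := hA ha
  obtain ⟨w⟩ := h p q
  obtain ⟨d, -, h1, h2⟩ := w.exists_boundary_dart (f ⁻¹' A) ha hq
  refine ⟨_, h1, _, ⟨⟨d.snd, rfl⟩, h2⟩, ?_⟩
  rcases d.adj.2 with h' | h'
  exacts [⟨true, hf _ _ h'⟩, ⟨false, hf _ _ h'⟩]

theorem ConnOn.preconnected (hD : D.Loopless) {W : Type*} {E : Digraph W} {f : W → V}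
    (hf : ∀ a b, D.Adj (f a) (f b) → E.Adj a b) (hinj : Function.Injective f)
    (hr : Set.range f = X) (h : D.ConnOn X) : E.underlying.Preconnected := by
  subst hr
  intro p q
  by_contra hq
  obtain ⟨_, ⟨a, ha, rfl⟩, _, ⟨⟨c, rfl⟩, hc⟩, b, hb⟩ :=
    h (f '' {w | E.underlying.Reachable p w}) (Set.image_subset_range _ _)
      ⟨f p, p, SimpleGraph.Reachable.refl p, rfl⟩
      ⟨f q, ⟨q, rfl⟩, fun ⟨w, hw, he⟩ => hq (hinj he ▸ hw)⟩
  refine hc ⟨c, SimpleGraph.Reachable.trans ha (SimpleGraph.Adj.reachable ⟨?_, ?_⟩), rfl⟩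
  · rintro rfl
    exact hD.notMem_nbr b _ hb
  · cases b
    exacts [.inr (hf _ _ hb), .inl (hf _ _ hb)]

theorem range_val_val (Y : Set V) (v : Y) :
    Set.range (fun w : ({v}ᶜ : Set Y) => ((w : Y) : V)) = Y \ {(v : V)} := by
  ext w
  constructor
  · rintro ⟨⟨w, hw⟩, rfl⟩
    exact ⟨w.2, fun e => hw (Subtype.ext e)⟩
  · rintro ⟨hw, hwv⟩
    exact ⟨⟨⟨w, hw⟩, fun e => hwv (congrArg Subtype.val e)⟩, rfl⟩

theorem Subdigraph.nonsep_verts {H : D.Subdigraph} (h : H.coe.IsConnected)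
    (h' : ∀ v, ¬ H.coe.IsSeparatingVertex v) : D.Nonsep H.verts := by
  refine ⟨Set.nonempty_coe_sort.mp h.nonempty,
    connOn_of_preconnected (f := Subtype.val) (fun a b hab => H.adj_sub hab) Subtype.range_val
      h.preconnected, fun v hv => ?_⟩
  let p : H.verts := ⟨v, hv⟩
  have h2 : (H.coe.induced {p}ᶜ).coe.underlying.Preconnected := not_not.mp (h' p)
  exact connOn_of_preconnected (E := (H.coe.induced {p}ᶜ).coe)
    (f := fun w : ({p}ᶜ : Set H.verts) => ((w : H.verts) : V))
    (fun a b hab => H.adj_sub hab.1) (range_val_val H.verts p) h2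

theorem Nonsep.induced (hD : D.Loopless) (h : D.Nonsep X) :
    (D.induced X).coe.IsConnected ∧ ∀ v, ¬ (D.induced X).coe.IsSeparatingVertex v := by
  have hc : (D.induced X).coe.underlying.Preconnected :=
    h.2.1.preconnected hD (f := Subtype.val) (fun a b hab => ⟨hab, a.2, b.2⟩)
      Subtype.val_injective Subtype.range_val
  refine ⟨(SimpleGraph.connected_iff _).mpr ⟨hc, h.1.to_subtype⟩, fun v => not_not.mpr ?_⟩
  exact (h.2.2 v v.2).preconnected hD
    (f := fun w : ({v}ᶜ : Set X) => ((w : X) : V))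
    (fun a b hab => ⟨⟨hab, a.1.2, b.1.2⟩, a.2, b.2⟩)
    (Subtype.val_injective.comp Subtype.val_injective) (range_val_val X v)

theorem Subdigraph.le_induced (H : D.Subdigraph) {Y : Set V} (h : H.verts ⊆ Y) :
    H ≤ D.induced Y :=
  ⟨h, fun _ _ hab => ⟨H.adj_sub hab, h (H.fst_mem hab), h (H.snd_mem hab)⟩⟩

/-- Adding all arcs of `D` between the vertices of a block creates no separating vertex, so by
maximality a block is induced and is determined by its vertex set. -/
theorem isBlockSet_verts (hD : D.Loopless) {B : D.Subdigraph} (hB : B ∈ D.blocks) :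
    D.IsBlockSet Set.univ B.verts ∧ B = D.induced B.verts := by
  have hns := Subdigraph.nonsep_verts hB.1.1 hB.1.2
  refine ⟨⟨⟨Set.subset_univ _, hns⟩, fun Z hZ hBZ => ?_⟩, ?_⟩
  · exact (hB.2 (hZ.2.induced hD) (B.le_induced hBZ)).1
  · exact le_antisymm (B.le_induced subset_rfl)
      (hB.2 (hns.induced hD) (B.le_induced subset_rfl))

theorem IsBlockSet.induced_mem_blocks (hD : D.Loopless) {Y : Set V}
    (hY : D.IsBlockSet Set.univ Y) : D.induced Y ∈ D.blocks :=
  ⟨hY.1.2.induced hD, fun H hH hYH => H.le_induced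
    (hY.2 ⟨Set.subset_univ _, Subdigraph.nonsep_verts hH.1 hH.2⟩ hYH.1)⟩

theorem IsColoringOn.isListColoring [Finite V] (hD : D.Loopless) {L : V → Set Γ} {φ : V → Γ}
    (h : D.IsColoringOn Set.univ (fun _ => L) φ) : D.IsListColoring L φ := by
  refine ⟨fun v => (h.exists_mem (Set.mem_univ v)).elim fun _ h' => h', fun α H => ?_⟩
  rintro ⟨n, hn, ⟨e⟩⟩
  let f : H.verts → V := fun w => ((w : (D.induced (φ ⁻¹' {α})).verts) : V)
  obtain ⟨_, ⟨u, rfl⟩, hv⟩ := h.exists_disjoint_nbr hD (T := Set.range f) (Set.subset_univ _)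
    ⟨_, e.symm 0, rfl⟩ (α := α) (by rintro _ ⟨w, rfl⟩; exact w.1.2) true
  -- The successor of `u` on the directed cycle contradicts that `f u` is a sink of the
  -- monochromatic set.
  have : H.coe.Adj u (e.symm (e u + 1)) := by
    rw [← e.map_rel_iff, e.apply_symm_apply]
    rfl
  exact hv (f (e.symm (e u + 1))) ⟨_, rfl⟩ (H.adj_sub this).1

theorem encard_nbr_inter [Finite V] (v : V) :
    (D.nbr true v ∩ Set.univ).encard = D.outDegree v ∧
      (D.nbr false v ∩ Set.univ).encard = D.inDegree v := by
  simp only [Set.inter_univ]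
  exact ⟨(Set.toFinite _).cast_ncard_eq.symm, (Set.toFinite _).cast_ncard_eq.symm⟩

/-- Blocks are out-regular, so the supremum is the common out-degree, which tightness identifies
with the number of colors of the block. -/
theorem coe_maxOutDegree_induced [Finite V] {k : ℕ∞} (hne : X.Nonempty)
    (h : ∀ v ∈ X, (D.nbr true v ∩ X).encard = k) : ((D.induced X).coe.maxOutDegree : ℕ∞) = k := by
  have hout : ∀ v : (D.induced X).verts, ((D.induced X).coe.outDegree v : ℕ∞) = k := by
    intro v
    have himage : Subtype.val '' {w | (D.induced X).coe.Adj v w} = D.nbr true v ∩ X := by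
      ext w
      constructor
      · rintro ⟨w, hw, rfl⟩
        exact ⟨hw.1, hw.2.2⟩
      · rintro ⟨hw, hwX⟩
        exact ⟨⟨w, hwX⟩, ⟨hw, v.2, hwX⟩, rfl⟩
    rw [← h v v.2, ← himage, Subtype.val_injective.encard_image]
    exact (Set.toFinite _).cast_ncard_eq
  obtain ⟨x, hx⟩ : Nonempty (D.induced X).verts := hne.to_subtype
  have : ∀ v, (D.induced X).coe.outDegree v = (D.induced X).coe.outDegree ⟨x, hx⟩ :=
    fun v => by exact_mod_cast (hout v).trans (hout ⟨x, hx⟩).symm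
  have hne : Nonempty (D.induced X).verts := ⟨⟨x, hx⟩⟩
  rw [← hout ⟨x, hx⟩, maxOutDegree, iSup_congr this, ciSup_const]

theorem Splits.blocksAt (hD : D.Loopless) {L : V → Set Γ} {C : Set V → Set Γ}
    (h : D.Splits Set.univ L C) (v : V) :
    (D.blocksAt v).PairwiseDisjoint (fun B => C B.verts) ∧
      L v = ⋃ B ∈ D.blocksAt v, C B.verts := by
  obtain ⟨h1, h2⟩ := h v (Set.mem_univ v)
  constructor
  · intro B hB B' hB' hne
    obtain ⟨hb, he⟩ := isBlockSet_verts hD hB.1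
    obtain ⟨hb', he'⟩ := isBlockSet_verts hD hB'.1
    exact h1 ⟨hb, hB.2⟩ ⟨hb', hB'.2⟩ fun e => hne (by rw [he, he', e])
  · rw [h2]
    refine Set.Subset.antisymm (Set.iUnion₂_subset fun Y hY => ?_)
      (Set.iUnion₂_subset fun B hB => ?_)
    · exact Set.subset_biUnion_of_mem (u := fun B : D.Subdigraph => C B.verts)
        (show D.induced Y ∈ D.blocksAt v from ⟨hY.1.induced_mem_blocks hD, hY.2⟩)
    · exact Set.subset_biUnion_of_mem (u := C) ⟨(isBlockSet_verts hD hB.1).1, hB.2⟩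

end Digraph

theorem mainTheorem3 {V Γ : Type*} [Finite V] (D : Digraph V) (hD : D.Loopless)
    (hconn : D.IsConnected) (L : V → Set Γ)
    (hL : ∀ v, ((max (D.outDegree v) (D.inDegree v) : ℕ) : ℕ∞) ≤ (L v).encard)
    (hcol : ¬ D.ListColorable L) :
    (D.IsEulerian ∧ ∀ v, (L v).encard = D.outDegree v ∧ (L v).encard = D.inDegree v) ∧
    (∀ B ∈ D.blocks, B.coe.IsDirectedCycle ∨ B.coe.IsBidirectedComplete ∨
      B.coe.IsBidirectedLongOddCycle) ∧
    (∃ C : D.Subdigraph → Set Γ,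
      (∀ B ∈ D.blocks, (C B).encard = B.coe.maxOutDegree) ∧
      ∀ v, (D.blocksAt v).PairwiseDisjoint C ∧ L v = ⋃ B ∈ D.blocksAt v, C B) := by
  have hX : D.ConnOn Set.univ := Digraph.connOn_of_preconnected (f := id) (fun _ _ => id)
    Set.range_id hconn.preconnected
  have := hconn.nonempty
  have hbad : D.BadOn Set.univ fun _ => L := by
    refine ⟨fun v _ b => le_trans ?_ (hL v), fun ⟨φ, hφ⟩ => hcol ⟨φ, hφ.isListColoring hD⟩⟩
    cases b
    · rw [Digraph.encard_nbr_inter v |>.2]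
      exact_mod_cast le_max_right _ _
    · rw [Digraph.encard_nbr_inter v |>.1]
      exact_mod_cast le_max_left _ _
  have hdeg : ∀ v, (L v).encard = D.outDegree v ∧ (L v).encard = D.inDegree v := fun v =>
    ⟨(hbad.encard_eq hD hX (Set.mem_univ v) true).trans (Digraph.encard_nbr_inter v).1,
      (hbad.encard_eq hD hX (Set.mem_univ v) false).trans (Digraph.encard_nbr_inter v).2⟩
  obtain ⟨C, hC, hblocks⟩ := hbad.structure hD hX Set.univ_nonempty
  refine ⟨⟨fun v => by exact_mod_cast (hdeg v).1.symm.trans (hdeg v).2, hdeg⟩, fun B hB => ?_,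
    fun B => C B.verts, fun B hB => ?_, hC.blocksAt hD⟩
  · obtain ⟨hb, he⟩ := Digraph.isBlockSet_verts hD hB
    rw [he]
    exact (hblocks _ hb).1
  · obtain ⟨hb, he⟩ := Digraph.isBlockSet_verts hD hB
    have := Digraph.coe_maxOutDegree_induced hb.1.2.1 (hblocks _ hb).2
    rw [he]
    exact this.symm
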